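/- Let $k\ge 2$ be an integer. Let $C_k$ be the best (largest) constant such that $$\|\underbrace{f*f*\cdots*f}_{k}\|_{L^\infty(\mathbb R)}\ \ge\ C_k\,\|f\|_{L^1(\mathbb R)}^k$$ for all nonnegative integrable functions $f:\mathbb R\to\mathbb R$ supported in $\left(-\tfrac1{2k},\tfrac1{2k}\right)$. For functions $f_1,\dots,f_k:\{0,1\}\to\mathbb R$, extended by zero to $\mathbb Z$, let $f_1*\cdots*f_k$ denote their convolution on $\mathbb Z$, that is $$(f_1*\cdots*f_k)(n)=\sum_{\substack{x_1,\dots,x_k\in\{0,1\}\\ x_1+\cdots+x_k=n}} f_1(x_1)\cdots f_k(x_k),$$ and let $C_{k,1}$ be the best (largest) constant such that $$\|f_1*f_2*\cdots*f_k\|_{\ell^\infty(\mathbb Z)}\ \ge\ C_{k,1}\prod_{i=1}^k\|f_i\|_{1},\qquad \|f_i\|_1=|f_i(0)|+|f_i(1)|,$$ for all nonnegative functions $f_1,\dots,f_k:\{0,1\}\to\mathbb R$. Then $$C_k\le 2k\,C_{k,1}.$$ -/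

import Mathlib

open MeasureTheory
open scoped ENNReal

/-- The `k`-fold self-convolution `f * f * ⋯ * f` (`k` factors) of `f : ℝ → ℝ` with respect to
Lebesgue measure, for `k ≥ 1` (the value at `k = 0` is a convention and is never used).
For integrable `f` the convolution integrals converge almost everywhere, so this is the usual
convolution as an almost everywhere defined function. -/
noncomputable def selfConv (f : ℝ → ℝ) : ℕ → ℝ → ℝ
  | 0 => 0
  | 1 => f
  | k + 2 => convolution f (selfConv f (k + 1)) (ContinuousLinearMap.mul ℝ ℝ) volume

/-- `C` is an admissible constant: `C ‖f‖₁ ^ k ≤ ‖f * ⋯ * f‖_∞` (`k` factors, essential supremum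
norm, possibly infinite) for every nonnegative integrable `f : ℝ → ℝ` supported in
`(-1/(2k), 1/(2k))`. -/
def IsContConst (k : ℕ) (C : ℝ≥0∞) : Prop :=
  ∀ f : ℝ → ℝ, (∀ x, 0 ≤ f x) → Integrable f volume →
    Function.support f ⊆ Set.Ioo (-(1 / (2 * (k : ℝ)))) (1 / (2 * (k : ℝ))) →
    C * eLpNorm f 1 volume ^ k ≤ eLpNorm (selfConv f k) ∞ volume

/-- The best constant `C_k` of the continuous problem. -/
noncomputable def contConst (k : ℕ) : ℝ≥0∞ := sSup {C | IsContConst k C}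

/-- The convolution `f₁ * ⋯ * f_k` on `ℤ` of functions `f_i : {0, …, m} → ℝ` (extended by zero):
`(f₁ * ⋯ * f_k)(n) = ∑_{x₁ + ⋯ + x_k = n} f₁(x₁) ⋯ f_k(x_k)`. -/
noncomputable def discreteConv {k m : ℕ} (f : Fin k → Fin (m + 1) → ℝ) (n : ℤ) : ℝ :=
  ∑ x : Fin k → Fin (m + 1) with ∑ i, ((x i : ℕ) : ℤ) = n, ∏ i, f i (x i)

/-- `C` is an admissible constant: `C ∏ ‖f_i‖₁ ≤ ‖f₁ * ⋯ * f_k‖_∞` for all nonnegative functions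
`f₁, …, f_k` on `{0, …, m}`. -/
def IsDiscreteConst (k m : ℕ) (C : ℝ≥0∞) : Prop :=
  ∀ f : Fin k → Fin (m + 1) → ℝ, (∀ i x, 0 ≤ f i x) →
    C * ∏ i, ∑ x, ‖f i x‖ₑ ≤ ⨆ n : ℤ, ‖discreteConv f n‖ₑ

/-- The best constant `C_{k,m}` of the discrete problem. -/
noncomputable def discreteConst (k m : ℕ) : ℝ≥0∞ := sSup {C | IsDiscreteConst k m C}

/-- The supremum defining `C_k` is attained: `C_k` is the largest admissible constant. -/
theorem isGreatest_contConst (k : ℕ) : IsGreatest {C | IsContConst k C} (contConst k) := by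
  refine ⟨fun f h0 hf hs => ?_, fun C hC => le_sSup hC⟩
  rw [contConst, ENNReal.sSup_mul]
  exact iSup₂_le fun C hC => hC f h0 hf hs

/-- The supremum defining `C_{k,m}` is attained: `C_{k,m}` is the largest admissible constant. -/
theorem isGreatest_discreteConst (k m : ℕ) :
    IsGreatest {C | IsDiscreteConst k m C} (discreteConst k m) := by
  refine ⟨fun f h0 => ?_, fun C hC => le_sSup hC⟩
  rw [discreteConst, ENNReal.sSup_mul]
  exact iSup₂_le fun C hC => hC f h0

/-- `C_{k,m}` is finite. -/
theorem discreteConst_ne_top (k m : ℕ) : discreteConst k m ≠ ∞ := by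
  have h := (isGreatest_discreteConst k m).1 (fun _ _ => 1) (fun _ _ => zero_le_one)
  have hb : (⨆ n : ℤ, ‖discreteConv (fun (_ : Fin k) (_ : Fin (m + 1)) => (1 : ℝ)) n‖ₑ)
      ≤ ((m + 1) ^ k : ℕ) := by
    refine iSup_le fun n => ?_
    have h1 : discreteConv (fun (_ : Fin k) (_ : Fin (m + 1)) => (1 : ℝ)) n =
        ((Finset.univ.filter fun x : Fin k → Fin (m + 1) =>
          ∑ i, ((x i : ℕ) : ℤ) = n).card : ℝ) := by
      simp [discreteConv]
    rw [h1, Real.enorm_natCast, Nat.cast_le]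
    refine (Finset.card_le_univ _).trans ?_
    simp
  intro htop
  rw [htop, ENNReal.top_mul] at h
  · exact absurd (h.trans hb) (by simp [-Nat.cast_pow])
  · rw [Finset.prod_ne_zero_iff]
    intro i _
    simp

/-! For positive `f i` the values of the discrete convolution are the coefficients of `∏ (f i 0 + f
i 1 * t)`, so by Newton's inequalities they equal `k.choose n * b n` with `b` log-concave. At a mode
`m`, some geometric sequence of ratio `x` is tangent to `b` and also makes `m` a mode of `k.choose n
* x ^ n`. Comparing sums with maxima (`exists_binomial_mode_le`) shows that `k` equal factors `(1,
x)` are the worst case. For equal factors, test the continuous problem on `u + x * u (· - h)`, where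
`u` is the indicator of an interval of length `h = 1 / (2k)`. Its `k`-th convolution power is a
binomial combination of translates of that of `u`, whose sum is at most `h ^ (k - 1)`; dividing by
`h ^ k` leaves the factor `1 / h = 2k` (`contConst_mul_le`). -/

/-! ### Newton's inequalities -/

/-- Sorting a discrete convolution of functions on `{0, 1}` by the value of the first variable. -/
theorem discreteConv_succ {k : ℕ} (f : Fin (k + 1) → Fin 2 → ℝ) (n : ℤ) :
    discreteConv (m := 1) f n = f 0 0 * discreteConv (m := 1) (Fin.tail f) n
      + f 0 1 * discreteConv (m := 1) (Fin.tail f) (n - 1) := by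
  simp only [discreteConv, Finset.sum_filter]
  rw [← (Fin.consEquiv fun _ => Fin 2).sum_comp, Fintype.sum_prod_type, Fin.sum_univ_two]
  simp only [Fin.consEquiv_apply, Fin.sum_univ_succ, Fin.prod_univ_succ, Fin.cons_zero,
    Fin.cons_succ, Finset.mul_sum, mul_ite, mul_zero, Fin.tail]
  congr 1 <;> refine Finset.sum_congr rfl fun x _ => ?_
  · simp
  · refine if_congr ?_ rfl rfl
    simp only [Fin.val_one, Nat.cast_one]
    omega

theorem discreteConv_of_neg {k m : ℕ} (f : Fin k → Fin (m + 1) → ℝ) {n : ℤ} (hn : n < 0) :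
    discreteConv f n = 0 := by
  rw [discreteConv, Finset.filter_eq_empty_iff.2, Finset.sum_empty]
  intro x _ hx
  have : (0 : ℤ) ≤ ∑ i, ((x i : ℕ) : ℤ) := Finset.sum_nonneg fun _ _ => by positivity
  omega

theorem discreteConv_nonneg {k m : ℕ} {f : Fin k → Fin (m + 1) → ℝ} (hf : ∀ i x, 0 ≤ f i x)
    (n : ℤ) : 0 ≤ discreteConv f n :=
  Finset.sum_nonneg fun _ _ => Finset.prod_nonneg fun _ _ => hf _ _

/-- This is the generating polynomial evaluated at `t = 1`. -/
theorem sum_discreteConv {k : ℕ} (f : Fin k → Fin 2 → ℝ) :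
    ∑ n ∈ Finset.range (k + 1), discreteConv (m := 1) f n = ∏ i, ∑ x, f i x := by
  rw [Finset.prod_univ_sum, Fintype.piFinset_univ,
    ← Finset.sum_fiberwise_of_maps_to (s := Finset.univ) (t := Finset.range (k + 1))
      (g := fun x : Fin k → Fin 2 => ∑ i, (x i : ℕ))]
  · refine Finset.sum_congr rfl fun n _ => ?_
    simp only [discreteConv]
    refine Finset.sum_congr (Finset.filter_congr fun x _ => ?_) fun _ _ => rfl
    exact_mod_cast Iff.rfl
  · intro x _
    have : ∑ i, (x i : ℕ) ≤ ∑ _i : Fin k, 1 := Finset.sum_le_sum fun i _ => by omega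
    simp at this
    simp; omega

/-- The inequality behind Newton's inequalities: multiplying a polynomial by a linear factor
preserves log-concavity of the binomially normalised coefficients. -/
theorem newton_step {α β n L u v w z : ℝ} (hα : 0 ≤ α) (hβ : 0 ≤ β) (hn : 1 ≤ n) (hL : 1 ≤ L)
    (h1 : (n - 1) * (u * w) ≤ (n - 1) * v ^ 2) (h2 : (L - 1) * (v * z) ≤ (L - 1) * w ^ 2)
    (h3 : (n - 1) * (L - 1) * (u * z) ≤ (n - 1) * (L - 1) * (v * w)) :
    ((L + 1) * α * v + (n - 1) * β * u) * ((L - 1) * α * z + (n + 1) * β * w)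
      ≤ (L * α * w + n * β * v) ^ 2 := by
  -- Once the three hypotheses are used, the remaining difference is exactly `(α * w - β * v) ^ 2`.
  nlinarith [sq_nonneg (α * w - β * v),
    mul_le_mul_of_nonneg_left h1 (show 0 ≤ β ^ 2 * (n + 1) by positivity),
    mul_le_mul_of_nonneg_left h2 (show 0 ≤ α ^ 2 * (L + 1) by positivity),
    mul_le_mul_of_nonneg_left h3 (show 0 ≤ α * β by positivity)]

/-- Newton's inequalities for the discrete convolution of positive functions on `{0, 1}`. -/
theorem exists_logConcave_discreteConv {k : ℕ} (f : Fin k → Fin 2 → ℝ) (hf : ∀ i x, 0 < f i x) :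
    ∃ b : ℕ → ℝ, (∀ n ≤ k, 0 < b n) ∧ (∀ n, n + 2 ≤ k → b n * b (n + 2) ≤ b (n + 1) ^ 2) ∧
      ∀ n : ℕ, discreteConv (m := 1) f n = k.choose n * b n := by
  induction k with
  | zero =>
    refine ⟨fun _ => 1, fun _ _ => one_pos, fun _ _ => by norm_num, fun n => ?_⟩
    rcases n with _ | n
    · simp [discreteConv]
    · have : ¬ (0 : ℤ) = n + 1 := by omega
      simp [discreteConv, this]
  | succ k ih =>
    obtain ⟨b, hb, hlc, hc⟩ := ih (Fin.tail f) fun i x => hf _ _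
    have hα := hf 0 0
    have hβ := hf 0 1
    set α := f 0 0
    set β := f 0 1
    -- Forced by the recursion of `discreteConv_succ` after division by `(k + 1).choose n`; at `n =
    -- 0` the truncated `b (n - 1)` has coefficient zero.
    let c : ℕ → ℝ := fun n => ((k + 1 - n : ℝ) * α * b n + n * β * b (n - 1)) / (k + 1)
    have hk : (0 : ℝ) < k + 1 := by positivity
    refine ⟨c, fun n hn => ?_, fun n hn => ?_, fun n => ?_⟩
    · refine div_pos ?_ hk
      rcases n with _ | n
      · have := hb 0 (Nat.zero_le _)
        simp only [Nat.cast_zero, sub_zero, zero_mul, add_zero]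
        positivity
      · have h1 := hb n (by omega)
        have h2 : 0 ≤ (k + 1 - (n + 1 : ℕ) : ℝ) * α * b (n + 1) := by
          rcases (Nat.le_of_succ_le_succ hn).eq_or_lt with rfl | h
          · simp
          · have := hb (n + 1) h
            have : (0 : ℝ) ≤ k + 1 - (n + 1 : ℕ) := by
              rw [sub_nonneg]; exact_mod_cast hn
            positivity
        have : 0 < ((n + 1 : ℕ) : ℝ) * β * b (n + 1 - 1) := by
          simp only [Nat.add_sub_cancel]; positivity
        linarith
    · simp only [c]
      rw [div_mul_div_comm, div_pow, ← sq]
      refine div_le_div_of_nonneg_right ?_ (by positivity)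
      have hbn := hb n (by omega)
      have hbn1 := hb (n + 1) (by omega)
      have hnk : ((n : ℝ) + 2) ≤ k + 1 := by exact_mod_cast hn
      have h2 : (n + 2 ≤ k) ∨ (k : ℝ) - n - 1 = 0 := by
        rcases Nat.lt_or_ge k (n + 2) with h | h
        · right
          have : k = n + 1 := by omega
          subst this; push_cast; ring
        · exact Or.inl h
      have h1 : (1 ≤ n) ∨ (n : ℝ) = 0 := by
        rcases n with _ | n
        · right; simp
        · left; omega
      have hl : n + 2 ≤ k → b n * b (n + 2) ≤ b (n + 1) ^ 2 := hlc n
      have hl' : 1 ≤ n → b (n - 1) * b (n + 1) ≤ b n ^ 2 := by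
        intro h
        obtain ⟨n, rfl⟩ := Nat.exists_eq_add_of_le' h
        exact hlc n (by omega)
      have hl3 : 1 ≤ n → n + 2 ≤ k → b (n - 1) * b (n + 2) ≤ b n * b (n + 1) := by
        intro h h'
        have p1 := hb (n - 1) (by omega)
        have p2 := hb (n + 2) (by omega)
        refine le_of_mul_le_mul_right ?_ (mul_pos hbn hbn1)
        calc _ = (b (n - 1) * b (n + 1)) * (b n * b (n + 2)) := by ring
          _ ≤ b n ^ 2 * b (n + 1) ^ 2 :=
            mul_le_mul (hl' h) (hl h') (by positivity) (by positivity)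
          _ = _ := by ring
      -- At the ends of the range, `b (n - 1)` or `b (n + 2)` is meaningless, but then the factor
      -- `n` or `k - n - 1` vanishes.
      have key := newton_step (α := α) (β := β) (n := n + 1) (L := k - n) (u := b (n - 1))
        (v := b n) (w := b (n + 1)) (z := b (n + 2)) hα.le hβ.le (by linarith [n.cast_nonneg (α := ℝ)])
        (by linarith) ?_ ?_ ?_
      · push_cast
        refine le_trans (le_of_eq ?_) (key.trans (le_of_eq ?_)) <;> ring
      · rcases h1 with h | h
        · exact mul_le_mul_of_nonneg_left (hl' h) (by simp)
        · simp [h]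
      · rcases h2 with h | h
        · exact mul_le_mul_of_nonneg_left (hl h) (by linarith)
        · simp [h]
      · rcases h1 with h | h
        · rcases h2 with h' | h'
          · exact mul_le_mul_of_nonneg_left (hl3 h h') (mul_nonneg (by simp) (by linarith))
          · simp [h']
        · simp [h]
    · rw [discreteConv_succ, hc n]
      simp only [c]
      rcases n with _ | n
      · rw [discreteConv_of_neg _ (by simp)]
        simp [α]
        field_simp
      · have : ((n + 1 : ℕ) : ℤ) - 1 = (n : ℕ) := by push_cast; ring
        rw [this, hc n, Nat.add_sub_cancel]
        have e1 : ((k + 1 : ℕ).choose (n + 1) : ℝ) * (n + 1) = (k + 1) * k.choose n := by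
          exact_mod_cast (Nat.add_one_mul_choose_eq k n).symm
        have e2 : ((k + 1 : ℕ).choose (n + 1) : ℝ) * (k - n) = (k + 1) * k.choose (n + 1) := by
          have : ((k + 1 : ℕ).choose (n + 1) : ℝ) = k.choose n + k.choose (n + 1) := by
            exact_mod_cast Nat.choose_succ_succ k n
          rw [this] at e1 ⊢
          linear_combination -e1
        field_simp
        push_cast
        linear_combination (-(α * b (n + 1))) * e2 - (β * b n) * e1

/-! ### Geometric majorants and the extremal case -/

/-- A sequence that grows at most like `x ^ n` after `m` and at least like `x ^ n` before `m` lies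
below the geometric sequence through its value at `m`. -/
theorem mul_pow_le_of_ratio {k m : ℕ} (hm : m ≤ k) {x : ℝ} (hx : 0 < x) {b : ℕ → ℝ}
    (hup : ∀ n, m ≤ n → n + 1 ≤ k → b (n + 1) ≤ x * b n)
    (hdown : ∀ n, n + 1 ≤ m → x * b n ≤ b (n + 1)) {n : ℕ} (hn : n ≤ k) :
    b n * x ^ m ≤ b m * x ^ n := by
  rcases le_total m n with h | h
  · induction n, h using Nat.le_induction with
    | base => rfl
    | succ n h ih =>
      calc b (n + 1) * x ^ m ≤ x * b n * x ^ m := by gcongr; exact hup n h hn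
        _ = x * (b n * x ^ m) := by ring
        _ ≤ x * (b m * x ^ n) := mul_le_mul_of_nonneg_left (ih (by omega)) hx.le
        _ = _ := by ring
  · induction h using Nat.decreasingInduction with
    | self => rfl
    | of_succ n h ih =>
      refine le_of_mul_le_mul_left ?_ hx
      calc x * (b n * x ^ m) = x * b n * x ^ m := by ring
        _ ≤ b (n + 1) * x ^ m := by gcongr; exact hdown n h
        _ ≤ b m * x ^ (n + 1) := ih (by omega)
        _ = _ := by ring

/-- A log-concave sequence lies below each geometric sequence tangent to it at `m`. -/
theorem mul_pow_le_of_logConcave {k m : ℕ} (hm : m ≤ k) {x : ℝ} (hx : 0 < x) {b : ℕ → ℝ}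
    (hb : ∀ n ≤ k, 0 < b n) (hlc : ∀ n, n + 2 ≤ k → b n * b (n + 2) ≤ b (n + 1) ^ 2)
    (hup : m + 1 ≤ k → b (m + 1) ≤ x * b m) (hdown : ∀ n, n + 1 = m → x * b n ≤ b m) {n : ℕ}
    (hn : n ≤ k) : b n * x ^ m ≤ b m * x ^ n := by
  refine mul_pow_le_of_ratio hm hx (fun n h hn => ?_) (fun n h => ?_) hn
  · induction n, h using Nat.le_induction with
    | base => exact hup hn
    | succ n h ih =>
      refine le_of_mul_le_mul_left ?_ (hb n (by omega))
      calc _ ≤ b (n + 1) ^ 2 := hlc n hn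
        _ = b (n + 1) * b (n + 1) := sq _
        _ ≤ b (n + 1) * (x * b n) := by
          gcongr
          · exact (hb _ (by omega)).le
          · exact ih (by omega)
        _ = _ := by ring
  · obtain ⟨m, rfl⟩ : ∃ m', m = m' + 1 := ⟨m - 1, by omega⟩
    have h : n ≤ m := by omega
    induction h using Nat.decreasingInduction with
    | self => exact hdown m rfl
    | of_succ n h ih =>
      refine le_of_mul_le_mul_right ?_ (hb (n + 2) (by omega))
      calc x * b n * b (n + 2) = x * (b n * b (n + 2)) := by ring
        _ ≤ x * b (n + 1) ^ 2 := by gcongr; exact hlc n (by omega)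
        _ = b (n + 1) * (x * b (n + 1)) := by ring
        _ ≤ b (n + 1) * b (n + 2) := by
          gcongr
          · exact (hb _ (by omega)).le
          · exact ih (by omega)

/-- Among discrete convolutions of positive functions on `{0, 1}`, the maximal value relative to the
product of the norms is smallest for convolution powers. -/
theorem exists_binomial_mode_le {k : ℕ} (hk : 1 ≤ k) (f : Fin k → Fin 2 → ℝ)
    (hf : ∀ i x, 0 < f i x) :
    ∃ m ≤ k, ∃ x : ℝ, 0 < x ∧ (∀ n ≤ k, (k.choose n : ℝ) * x ^ n ≤ k.choose m * x ^ m) ∧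
      (∏ i, ∑ j, f i j) * (k.choose m * x ^ m) ≤ (1 + x) ^ k * discreteConv (m := 1) f m := by
  obtain ⟨b, hb, hlc, hc⟩ := exists_logConcave_discreteConv f hf
  obtain ⟨m, hm, hmax⟩ := Finset.exists_max_image (Finset.range (k + 1))
    (fun n : ℕ => (k.choose n : ℝ) * b n) ⟨0, by simp⟩
  simp only [Finset.mem_range, Nat.lt_succ_iff] at hm hmax
  have hbm := hb m hm
  have hsucc : ∀ n : ℕ, (k.choose (n + 1) : ℝ) * (n + 1) = k.choose n * (k - n) := by
    intro n
    rcases le_or_gt n k with h | h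
    · have := Nat.choose_succ_right_eq k n
      rw [← Nat.cast_sub h]
      exact_mod_cast this
    · simp [Nat.choose_eq_zero_of_lt h, Nat.choose_eq_zero_of_lt (h.trans (Nat.lt_succ_self n))]
  have hpos : ∀ n ≤ k, (0 : ℝ) < k.choose n := fun n hn => by exact_mod_cast Nat.choose_pos hn
  have hmk : (m : ℝ) ≤ k := by exact_mod_cast hm
  have hden : (0 : ℝ) < k - m + 1 := by linarith
  -- upper slope at the mode
  have hρ : m + 1 ≤ k → (k - m) * b (m + 1) ≤ (m + 1) * b m := by
    intro h
    have h1 := hmax (m + 1) h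
    refine le_of_mul_le_mul_left ?_ (hpos m hm)
    calc _ = (k.choose m * (k - m)) * b (m + 1) := by ring
      _ = (m + 1) * (k.choose (m + 1) * b (m + 1)) := by rw [← hsucc]; ring
      _ ≤ (m + 1) * (k.choose m * b m) := by gcongr
      _ = _ := by ring
  have hσ : ∀ n, n + 1 = m → m * b n ≤ (k - m + 1) * b m := by
    rintro n rfl
    have h1 := hmax n (by omega)
    refine le_of_mul_le_mul_left ?_ (hpos n (by omega))
    push_cast at hden ⊢
    calc _ = (n + 1) * (k.choose n * b n) := by ring
      _ ≤ (n + 1) * (k.choose (n + 1) * b (n + 1)) := by gcongr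
      _ = k.choose (n + 1) * (n + 1) * b (n + 1) := by ring
      _ = _ := by rw [hsucc]; ring
  -- The mode condition asks for `m / (k - m + 1) ≤ x ≤ (m + 1) / (k - m)`, tangency for `b (m + 1)
  -- / b m ≤ x ≤ b m / b (m - 1)`. By `hρ`, `hσ` and log-concavity each lower bound is below each
  -- upper one, so the larger lower bound serves. If `m = k`, only the first lower bound remains.
  obtain ⟨x, hx, hx1, hx2, hup, hdown⟩ : ∃ x : ℝ, 0 < x ∧ (m : ℝ) ≤ x * (k - m + 1) ∧
      x * (k - m) ≤ m + 1 ∧ (m + 1 ≤ k → b (m + 1) ≤ x * b m) ∧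
      ∀ n, n + 1 = m → x * b n ≤ b m := by
    have hq : (m / (k - m + 1) : ℝ) * (k - m) ≤ m + 1 := by
      rw [div_mul_eq_mul_div, div_le_iff₀ hden]
      nlinarith [m.cast_nonneg (α := ℝ)]
    have hqd : ∀ n, n + 1 = m → (m / (k - m + 1) : ℝ) * b n ≤ b m := by
      intro n hn
      rw [div_mul_eq_mul_div, div_le_iff₀ hden]
      linarith [hσ n hn]
    rcases hm.eq_or_lt with h | h
    · refine ⟨m / (k - m + 1), div_pos ?_ hden, ?_, hq, fun h => by omega, hqd⟩
      · exact_mod_cast (by omega : 0 < m)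
      · rw [div_mul_cancel₀ _ hden.ne']
    · have hb1 := hb (m + 1) h
      rcases le_total (b (m + 1) / b m) (m / (k - m + 1)) with hc | hc
      · refine ⟨m / (k - m + 1), (div_pos hb1 hbm).trans_le hc, ?_, hq, fun _ => ?_, hqd⟩
        · rw [div_mul_cancel₀ _ hden.ne']
        · rwa [div_le_iff₀ hbm] at hc
      · refine ⟨b (m + 1) / b m, div_pos hb1 hbm, ?_, ?_, fun _ => ?_, ?_⟩
        · rwa [div_le_iff₀ hden] at hc
        · rw [div_mul_eq_mul_div, div_le_iff₀ hbm]
          linarith [hρ h]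
        · rw [div_mul_cancel₀ _ hbm.ne']
        · rintro n rfl
          rw [div_mul_eq_mul_div, div_le_iff₀ hbm]
          linarith [hlc n h]
  have htan : ∀ n ≤ k, b n * x ^ m ≤ b m * x ^ n := fun n hn =>
    mul_pow_le_of_logConcave hm hx hb hlc hup hdown hn
  refine ⟨m, hm, x, hx, fun n hn => ?_, ?_⟩
  · have := mul_pow_le_of_ratio (b := fun n => (k.choose n : ℝ) * x ^ n) hm one_pos ?_ ?_ hn
    · simpa using this
    · intro n h h'
      have hnk : (n : ℝ) + 1 ≤ k := by exact_mod_cast h'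
      have hmn : (m : ℝ) ≤ n := by exact_mod_cast h
      have h3 : x * (k - n) ≤ n + 1 :=
        (mul_le_mul_of_nonneg_left (by linarith) hx.le).trans (hx2.trans (by linarith))
      refine le_of_mul_le_mul_left ?_ (show (0 : ℝ) < n + 1 by positivity)
      calc _ = k.choose (n + 1) * (n + 1) * (x ^ n * x) := by ring
        _ = (x * (k - n)) * (k.choose n * x ^ n) := by rw [hsucc]; ring
        _ ≤ (n + 1) * (k.choose n * x ^ n) := by gcongr
        _ = _ := by ring
    · intro n h
      have hmn : (n : ℝ) + 1 ≤ m := by exact_mod_cast h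
      have h3 : (n : ℝ) + 1 ≤ x * (k - n) := by
        have : x * (k - m + 1) ≤ x * (k - n) := mul_le_mul_of_nonneg_left (by linarith) hx.le
        linarith
      refine le_of_mul_le_mul_left ?_ (show (0 : ℝ) < n + 1 by positivity)
      calc _ = (n + 1) * (k.choose n * x ^ n) := by ring
        _ ≤ (x * (k - n)) * (k.choose n * x ^ n) := by gcongr
        _ = k.choose (n + 1) * (n + 1) * (x ^ n * x) := by rw [hsucc]; ring
        _ = _ := by ring
  · rw [← sum_discreteConv, hc m, Finset.sum_mul, add_comm 1 x, add_pow, Finset.sum_mul]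
    refine Finset.sum_le_sum fun n hn => ?_
    rw [hc n, one_pow, mul_one]
    have := htan n (by simpa [Nat.lt_succ_iff] using hn)
    calc _ = k.choose n * k.choose m * (b n * x ^ m) := by ring
      _ ≤ k.choose n * k.choose m * (b m * x ^ n) := by gcongr
      _ = _ := by ring
-- Convolution powers of step functions
theorem selfConv_succ_succ (f : ℝ → ℝ) (k : ℕ) (y : ℝ) :
    selfConv f (k + 2) y = ∫ t, f t * selfConv f (k + 1) (y - t) := rfl

theorem integrable_selfConv {f : ℝ → ℝ} (hf : Integrable f) (k : ℕ) :
    Integrable (selfConv f (k + 1)) := by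
  induction k with
  | zero => exact hf
  | succ k ih => exact hf.integrable_convolution _ ih

theorem selfConv_nonneg {f : ℝ → ℝ} (hf : ∀ x, 0 ≤ f x) (k : ℕ) (y : ℝ) :
    0 ≤ selfConv f (k + 1) y := by
  induction k generalizing y with
  | zero => exact hf y
  | succ k ih => exact integral_nonneg fun t => mul_nonneg (hf t) (ih _)

/-- Boundedness of `u` makes the convolution integrals converge at every `y`, so the identities
below hold pointwise. -/
theorem integrable_mul_comp_sub {u g : ℝ → ℝ} (hu : Integrable u) (hu1 : ∀ t, ‖u t‖ ≤ 1)
    (hg : Integrable g) (y : ℝ) : Integrable fun t => u t * g (y - t) :=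
  (hg.comp_sub_left y).bdd_mul hu.aestronglyMeasurable (.of_forall hu1)

/-- The convolution powers of `u + x u(· - h)`. -/
theorem selfConv_add_translate {u : ℝ → ℝ} (hu : Integrable u) (hu1 : ∀ t, ‖u t‖ ≤ 1) (x h : ℝ)
    (k : ℕ) (y : ℝ) :
    selfConv (fun t => u t + x * u (t - h)) (k + 1) y =
      ∑ n ∈ Finset.range (k + 2), ((k + 1).choose n : ℝ) * x ^ n * selfConv u (k + 1) (y - n * h) := by
  induction k generalizing y with
  | zero => simp [Finset.sum_range_succ, selfConv]
  | succ k ih =>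
    have hφ := integrable_selfConv hu k
    set g : ℝ → ℝ := fun y => ∑ n ∈ Finset.range (k + 2),
      ((k + 1).choose n : ℝ) * x ^ n * selfConv u (k + 1) (y - n * h) with hg
    have hgi : Integrable g := by
      refine integrable_finsetSum _ fun n _ => Integrable.const_mul ?_ _
      exact hφ.comp_sub_right _
    have hT : ∀ y, ∫ t, u t * g (y - t) = ∑ n ∈ Finset.range (k + 2),
        ((k + 1).choose n : ℝ) * x ^ n * selfConv u (k + 2) (y - n * h) := by
      intro y
      simp only [hg, Finset.mul_sum, selfConv_succ_succ]
      rw [integral_finsetSum]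
      · refine Finset.sum_congr rfl fun n _ => ?_
        rw [← integral_const_mul]
        refine integral_congr_ae (.of_forall fun t => ?_)
        simp only [sub_right_comm y t]
        ring
      · intro n _
        have := (integrable_mul_comp_sub hu hu1 hφ (y - n * h)).const_mul
          (((k + 1).choose n : ℝ) * x ^ n)
        refine this.congr (.of_forall fun t => ?_)
        simp only [sub_right_comm y t]
        ring
    have hshift : ∫ t, u (t - h) * g (y - t) = ∫ t, u t * g (y - h - t) := by
      rw [← integral_sub_right_eq_self (fun t => u t * g (y - h - t)) h]
      refine integral_congr_ae (.of_forall fun t => ?_)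
      simp only [sub_sub, add_sub_cancel]
    have hi1 := integrable_mul_comp_sub hu hu1 hgi y
    have hi2 := integrable_mul_comp_sub (hu.comp_sub_right h) (fun t => hu1 _) hgi y
    rw [selfConv_succ_succ]
    calc _ = ∫ t, (u t * g (y - t) + x * (u (t - h) * g (y - t))) := by
          refine integral_congr_ae (.of_forall fun t => ?_)
          simp only [ih]
          ring
      _ = (∫ t, u t * g (y - t)) + x * ∫ t, u t * g (y - h - t) := by
          rw [integral_add hi1 (hi2.const_mul x), integral_const_mul, hshift]
      _ = _ := by
          rw [hT, hT, Finset.sum_range_succ' _ (k + 2), Finset.sum_range_succ' _ (k + 1)]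
          -- The added term has coefficient `(k + 1).choose (k + 2) = 0`; both sums then share a
          -- range and Pascal's rule applies.
          have hlast : ∑ n ∈ Finset.range (k + 1), ((k + 1).choose (n + 1) : ℝ) * x ^ (n + 1) *
                selfConv u (k + 2) (y - (n + 1 : ℕ) * h) =
              ∑ n ∈ Finset.range (k + 2), ((k + 1).choose (n + 1) : ℝ) * x ^ (n + 1) *
                selfConv u (k + 2) (y - (n + 1 : ℕ) * h) := by
            rw [Finset.sum_range_succ _ (k + 1)]
            simp
          rw [hlast, Finset.mul_sum, add_right_comm, ← Finset.sum_add_distrib]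
          congr 1
          · refine Finset.sum_congr rfl fun n _ => ?_
            rw [Nat.choose_succ_succ (k + 1) n,
              show y - h - n * h = y - (n + 1 : ℕ) * h by push_cast; ring]
            push_cast
            ring

/-- If the translates of `u` add up to at most `1`, then those of its convolution powers add up to
at most a power of its integral. -/
theorem sum_selfConv_translate_le {u : ℝ → ℝ} (hu0 : ∀ t, 0 ≤ u t) (hu : Integrable u)
    (hu1 : ∀ t, ‖u t‖ ≤ 1) {h : ℝ} {s : Finset ℕ} (hs : ∀ y, ∑ n ∈ s, u (y - n * h) ≤ 1)
    (k : ℕ) (y : ℝ) :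
    ∑ n ∈ s, selfConv u (k + 1) (y - n * h) ≤ (∫ t, u t) ^ k := by
  induction k generalizing y with
  | zero => simpa [selfConv] using hs y
  | succ k ih =>
    have hi : ∀ n ∈ s, Integrable fun t => u t * selfConv u (k + 1) (y - n * h - t) :=
      fun n _ => integrable_mul_comp_sub hu hu1 (integrable_selfConv hu k) _
    simp only [selfConv_succ_succ]
    -- Only the innermost factor is summed over translates; each further factor contributes its
    -- integral.
    rw [← integral_finsetSum _ hi, pow_succ, ← integral_const_mul]
    refine integral_mono (integrable_finsetSum _ hi) (hu.const_mul _) fun t => ?_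
    simp only [← Finset.mul_sum]
    rw [mul_comm]
    refine mul_le_mul_of_nonneg_right ?_ (hu0 t)
    simpa only [sub_right_comm] using ih (y - t)

theorem sum_indicator_Ioo_translate_le {h : ℝ} (s : Finset ℕ) (y : ℝ) :
    ∑ n ∈ s, (Set.Ioo (-h) 0).indicator (fun _ => (1 : ℝ)) (y - n * h) ≤ 1 := by
  rcases le_or_gt h 0 with hh | hh
  · simp [Set.Ioo_eq_empty_of_le (show (0 : ℝ) ≤ -h by linarith)]
  by_cases H : ∃ n ∈ s, y - n * h ∈ Set.Ioo (-h) 0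
  · obtain ⟨n, hn, hy⟩ := H
    rw [Finset.sum_eq_single_of_mem n hn]
    · rw [Set.indicator_of_mem hy]
    · intro m _ hmn
      refine Set.indicator_of_notMem (fun hm => hmn ?_) _
      have h1 : ((m : ℝ) - n) * h < 1 * h := by linarith [hm.1, hm.2, hy.1, hy.2]
      have h2 : ((n : ℝ) - m) * h < 1 * h := by linarith [hm.1, hm.2, hy.1, hy.2]
      have h3 : (m : ℝ) < n + 1 := by linarith [lt_of_mul_lt_mul_right h1 hh.le]
      have h4 : (n : ℝ) < m + 1 := by linarith [lt_of_mul_lt_mul_right h2 hh.le]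
      norm_cast at h3 h4
      omega
  · rw [Finset.sum_eq_zero]
    · exact zero_le_one
    · exact fun n hn => Set.indicator_of_notMem (fun hy => H ⟨n, hn, hy⟩) _

/-- Testing the continuous problem on a step function with two steps. -/
theorem contConst_mul_le {k : ℕ} (hk : 1 ≤ k) {x M : ℝ} (hx : 0 ≤ x)
    (hM : ∀ n ≤ k, (k.choose n : ℝ) * x ^ n ≤ M) :
    contConst k * ENNReal.ofReal ((1 + x) ^ k) ≤ ENNReal.ofReal (2 * k * M) := by
  obtain ⟨k, rfl⟩ := Nat.exists_eq_add_of_le' hk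
  -- The permitted support `(-h, h)` holds exactly two steps of length `h`.
  obtain ⟨h, hh⟩ : ∃ h : ℝ, h = 1 / (2 * ((k + 1 : ℕ) : ℝ)) := ⟨_, rfl⟩
  have hpos : 0 < h := by rw [hh]; positivity
  set u : ℝ → ℝ := (Set.Ioo (-h) 0).indicator fun _ => 1 with hu_def
  have hu0 : ∀ t, 0 ≤ u t := fun t => Set.indicator_nonneg (fun _ _ => zero_le_one) t
  have hu1 : ∀ t, ‖u t‖ ≤ 1 := fun t => by
    simpa using norm_indicator_le_norm_self (s := Set.Ioo (-h) 0) (fun _ => (1 : ℝ)) t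
  have hu : Integrable u := (integrable_indicator_iff measurableSet_Ioo).2
    (integrableOn_const (by simp))
  have hint : ∫ t, u t = h := by
    rw [hu_def, integral_indicator measurableSet_Ioo]
    simp [hpos.le]
  set f : ℝ → ℝ := fun t => u t + x * u (t - h) with hf_def
  have hf0 : ∀ t, 0 ≤ f t := fun t => add_nonneg (hu0 _) (mul_nonneg hx (hu0 _))
  have hf : Integrable f := hu.add ((hu.comp_sub_right h).const_mul x)
  have hfint : ∫ t, f t = (1 + x) * h := by
    rw [hf_def, integral_add hu ((hu.comp_sub_right h).const_mul x), integral_const_mul,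
      integral_sub_right_eq_self u h, hint]
    ring
  have hsupp : Function.support f ⊆ Set.Ioo (-h) h := by
    intro t ht
    by_contra hn
    refine ht ?_
    have h1 : u t = 0 := Set.indicator_of_notMem (fun hm => hn ⟨hm.1, hm.2.trans hpos⟩) _
    have h2 : u (t - h) = 0 :=
      Set.indicator_of_notMem (fun hm => hn ⟨by linarith [hm.1], by linarith [hm.2]⟩) _
    simp [hf_def, h1, h2]
  have key := (isGreatest_contConst (k + 1)).1 f hf0 hf (hh ▸ hsupp)
  have hbound : ∀ y, selfConv f (k + 1) y ≤ M * h ^ k := by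
    intro y
    have hM0 : 0 ≤ M := le_trans (by simp) (hM 0 (Nat.zero_le _))
    rw [hf_def, selfConv_add_translate hu hu1]
    calc _ ≤ ∑ n ∈ Finset.range (k + 2), M * selfConv u (k + 1) (y - n * h) :=
          Finset.sum_le_sum fun n hn => mul_le_mul_of_nonneg_right
            (hM n (by have := Finset.mem_range.1 hn; omega)) (selfConv_nonneg hu0 _ _)
      _ = M * ∑ n ∈ Finset.range (k + 2), selfConv u (k + 1) (y - n * h) := by
          rw [Finset.mul_sum]
      _ ≤ M * h ^ k := by
          refine mul_le_mul_of_nonneg_left ?_ hM0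
          conv_rhs => rw [← hint]
          exact sum_selfConv_translate_le hu0 hu hu1
            (fun y => sum_indicator_Ioo_translate_le _ y) k y
  have hnorm : eLpNorm f 1 volume = ENNReal.ofReal ((1 + x) * h) := by
    rw [eLpNorm_one_eq_lintegral_enorm, ← hfint, ofReal_integral_eq_lintegral_ofReal hf
      (.of_forall hf0)]
    exact lintegral_congr fun t => Real.enorm_of_nonneg (hf0 t)
  have hsup : eLpNorm (selfConv f (k + 1)) ∞ volume ≤ ENNReal.ofReal (M * h ^ k) := by
    rw [eLpNorm_exponent_top]
    refine eLpNormEssSup_le_of_ae_enorm_bound (.of_forall fun y => ?_)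
    rw [Real.enorm_of_nonneg (selfConv_nonneg hf0 _ _)]
    exact ENNReal.ofReal_le_ofReal (hbound y)
  rw [hnorm] at key
  have h1 := mul_le_mul_left (key.trans hsup) (ENNReal.ofReal ((h⁻¹) ^ (k + 1)))
  rw [← ENNReal.ofReal_pow (by positivity), mul_assoc, ← ENNReal.ofReal_mul (by positivity),
    ← ENNReal.ofReal_mul' (by positivity)] at h1
  have e1 : ((1 + x) * h) ^ (k + 1) * h⁻¹ ^ (k + 1) = (1 + x) ^ (k + 1) := by
    rw [← mul_pow, mul_assoc, mul_inv_cancel₀ hpos.ne', mul_one]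
  have e2 : M * h ^ k * h⁻¹ ^ (k + 1) = 2 * (k + 1 : ℕ) * M := by
    rw [pow_succ, inv_pow]
    have : h⁻¹ = 2 * (k + 1 : ℕ) := by rw [hh]; simp
    rw [← this]
    field_simp
  rwa [e1, e2] at h1

/-! ### Reduction to positive functions and conclusion -/

/-- Functions on `{0, 1}` may be assumed positive in the discrete problem. -/
theorem exists_le_discreteConv_of_pos {k : ℕ} {c : ℝ}
    (H : ∀ f : Fin k → Fin 2 → ℝ, (∀ i x, 0 < f i x) →
      ∃ m ≤ k, c * ∏ i, ∑ x, f i x ≤ discreteConv (m := 1) f (m : ℕ))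
    (f : Fin k → Fin 2 → ℝ) (hf : ∀ i x, 0 ≤ f i x) :
    ∃ m ≤ k, c * ∏ i, ∑ x, f i x ≤ discreteConv (m := 1) f (m : ℕ) := by
  by_contra! hcon
  let F : ℝ → Fin k → Fin 2 → ℝ := fun ε i x => f i x + ε
  have hF0 : F 0 = f := by simp [F]
  -- Failure at all of the finitely many `m` is an open condition, so it survives a small positive
  -- perturbation.
  have hev : ∀ᶠ ε in nhdsWithin (0 : ℝ) (Set.Ioi 0), ∀ m ∈ Finset.range (k + 1),
      discreteConv (m := 1) (F ε) (m : ℕ) < c * ∏ i, ∑ x, F ε i x := by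
    rw [Filter.eventually_all_finset]
    intro m hm
    refine Filter.Eventually.filter_mono nhdsWithin_le_nhds ?_
    have h1 : Continuous fun ε => discreteConv (m := 1) (F ε) (m : ℕ) := by
      simp only [discreteConv, F]; fun_prop
    have h2 : Continuous fun ε => c * ∏ i, ∑ x, F ε i x := by
      simp only [F]; fun_prop
    refine h1.continuousAt.eventually_lt h2.continuousAt ?_
    rw [hF0]
    exact hcon m (by simpa [Nat.lt_succ_iff] using hm)
  obtain ⟨ε, hε, hpos⟩ := (hev.and self_mem_nhdsWithin).exists
  obtain ⟨m, hm, hle⟩ := H (F ε) fun i x => add_pos_of_nonneg_of_pos (hf i x) hpos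
  exact absurd hle (not_le.2 (hε m (by simpa [Nat.lt_succ_iff] using hm)))

theorem mainTheorem4 (k : ℕ) (hk : 2 ≤ k) :
    contConst k ≤ 2 * (k : ℝ≥0∞) * discreteConst k 1 := by
  have hk1 : 1 ≤ k := by omega
  have hk0 : (0 : ℝ) < 2 * k := by positivity
  have htop : contConst k ≠ ∞ := by
    intro htop
    -- A single step already bounds the constant by `2k`.
    have := contConst_mul_le hk1 (x := 0) (M := 1) le_rfl fun n hn => by
      rcases n with _ | n <;> simp
    rw [htop, add_zero, one_pow, ENNReal.ofReal_one, mul_one, top_le_iff] at this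
    exact ENNReal.ofReal_ne_top this
  set c := (contConst k).toReal with hc
  have hcc : contConst k = ENNReal.ofReal c := (ENNReal.ofReal_toReal htop).symm
  have hc0 : 0 ≤ c := ENNReal.toReal_nonneg
  have hreal : ∀ f : Fin k → Fin 2 → ℝ, (∀ i x, 0 < f i x) →
      ∃ m ≤ k, c / (2 * k) * ∏ i, ∑ x, f i x ≤ discreteConv (m := 1) f (m : ℕ) := by
    intro f hf
    obtain ⟨m, hm, x, hx, hmode, hle⟩ := exists_binomial_mode_le hk1 f hf
    refine ⟨m, hm, ?_⟩
    have h1 := contConst_mul_le hk1 hx.le hmode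
    rw [hcc, ← ENNReal.ofReal_mul hc0, ENNReal.ofReal_le_ofReal_iff (by positivity)] at h1
    have hM : 0 < (k.choose m : ℝ) * x ^ m :=
      mul_pos (by exact_mod_cast Nat.choose_pos hm) (pow_pos hx _)
    have hconv := discreteConv_nonneg (m := 1) (fun i x => (hf i x).le) (m : ℤ)
    rw [div_mul_eq_mul_div, div_le_iff₀ hk0]
    refine le_of_mul_le_mul_right ?_ hM
    calc c * (∏ i, ∑ x, f i x) * (k.choose m * x ^ m)
        = c * ((∏ i, ∑ x, f i x) * (k.choose m * x ^ m)) := mul_assoc _ _ _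
      _ ≤ c * ((1 + x) ^ k * discreteConv (m := 1) f m) := by gcongr
      _ = (c * (1 + x) ^ k) * discreteConv (m := 1) f m := by ring
      _ ≤ (2 * k * (k.choose m * x ^ m)) * discreteConv (m := 1) f m := by gcongr
      _ = _ := by ring
  have hdisc : IsDiscreteConst k 1 (ENNReal.ofReal (c / (2 * k))) := by
    intro f hf
    obtain ⟨m, -, hle⟩ := exists_le_discreteConv_of_pos hreal f hf
    refine le_trans ?_ (le_iSup (fun n : ℤ => ‖discreteConv f n‖ₑ) (m : ℤ))
    have hs : ∀ i, ∑ x, ‖f i x‖ₑ = ENNReal.ofReal (∑ x, f i x) := fun i => by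
      rw [ENNReal.ofReal_sum_of_nonneg fun x _ => hf i x]
      exact Finset.sum_congr rfl fun x _ => Real.enorm_of_nonneg (hf i x)
    simp only [hs]
    rw [← ENNReal.ofReal_prod_of_nonneg fun i _ => Finset.sum_nonneg fun x _ => hf i x,
      ← ENNReal.ofReal_mul (by positivity), Real.enorm_of_nonneg (discreteConv_nonneg hf _)]
    exact ENNReal.ofReal_le_ofReal hle
  have h2k : (2 * (k : ℝ≥0∞)) = ENNReal.ofReal (2 * k) := by
    rw [ENNReal.ofReal_mul (by norm_num)]; simp
  calc contConst k = 2 * (k : ℝ≥0∞) * ENNReal.ofReal (c / (2 * k)) := by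
        rw [h2k, ← ENNReal.ofReal_mul hk0.le, mul_div_cancel₀ _ hk0.ne', hcc]
    _ ≤ _ := mul_le_mul_right ((isGreatest_discreteConst k 1).2 hdisc) _
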